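/- Let $R$ be a discrete valuation ring with uniformizer $\pi$ and fraction field $K$, let $L/K$ be a finite separable extension, and let $S$ be the integral closure of $R$ in $L$. We call $L/K$ \emph{unramified} if every maximal ideal of $S$ has ramification index $1$ over $R$ and a separable residue field extension, and \emph{ramified} if some maximal ideal of $S$ has ramification index $>1$. Let $A=R[t_1,\dots,t_n]/(f_1,\dots,f_r)$, $X=\operatorname{Spec}A$ and $X_S=X\times_R S$. Let $x$ be a closed point of $X$ whose maximal ideal, seen as an ideal of $R[t_1,\dots,t_n]$, is $(g_1,\dots,g_n,\pi)$ with $g_j\in R[t_1,\dots,t_n]$, and let $\kappa(x)$ be its residue field. Write $$f_i=\sum_{j=1}^n h_{ij}g_j+\pi c_i\qquad(h_{ij},c_i\in R[t_1,\dots,t_n])$$ and define, over $\kappa(x)$, $$\frac{\partial f_i}{\partial g_j}(x):=h_{ij}(x),\qquad \frac{f_i(x)}{\pi}:=c_i(x).$$ Assume that $x$ is a regular point of $X$. Then: (0) The matrix $\left(\frac{\partial f_i}{\partial g_j}(x)\right)$ and the column $\left(\frac{f_i(x)}{\pi}\right)$ are well defined, i.e. such expansions exist and the result does not depend on the choice of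 $h_{ij},c_i$. If $\kappa(x)$ is separable over the residue field $k=R/\pi$, then $\left(\frac{\partial f_i}{\partial g_j}(x)\right)$ is the unique matrix $J$ over $\kappa(x)$ with $\left(\frac{\partial f_i}{\partial t_j}(x)\right)=J\left(\frac{\partial g_i}{\partial t_j}(x)\right)$. (1) If $L/K$ is unramified, then every point of $X_S$ lying over $x$ is regular. (2) Suppose that $L/K$ is ramified, and that $\kappa(x)/k$ is separable or all residue field extensions of $S$ over $R$ are separable (both hold automatically if $k$ is perfect). Then every point of $X_S$ lying over $x$ is regular if and only if the system of linear equations $$\left(\frac{\partial f_i}{\partial g_j}(x)\right)\mathbf v=\left(\frac{f_i(x)}{\pi}\right)$$ has a solution $\mathbf v\in\kappa(x)^n$. -/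

import Mathlib

open scoped TensorProduct Matrix

namespace ArithJac

/-- The coordinate ring `A = R[t₁, …, tₙ] / (f₁, …, fᵣ)` of the affine `R`-scheme `X = Spec A`. -/
abbrev CoordRing (R : Type*) [CommRing R] {n r : ℕ} (f : Fin r → MvPolynomial (Fin n) R) : Type _ :=
  MvPolynomial (Fin n) R ⧸ Ideal.span (Set.range f)

/-- The coordinate ring `A ⊗[R] S` of the base change `X_S = X ×_R S`. -/
abbrev BaseChangeRing (R : Type*) [CommRing R] {n r : ℕ} (f : Fin r → MvPolynomial (Fin n) R)
    (S : Type*) [CommRing S] [Algebra R S] : Type _ :=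
  CoordRing R f ⊗[R] S

/-- A point of `Spec B` is regular if its local ring is a regular local ring. -/
def IsRegularPoint {B : Type*} [CommRing B] (x : PrimeSpectrum B) : Prop :=
  IsRegularLocalRing (Localization.AtPrime x.asIdeal)

/-- Every point of `X_S` lying over the point `x` of `X` is regular. -/
def FiberRegular {R : Type*} [CommRing R] {n r : ℕ} {f : Fin r → MvPolynomial (Fin n) R}
    (S : Type*) [CommRing S] [Algebra R S] (x : PrimeSpectrum (CoordRing R f)) : Prop :=
  ∀ y : PrimeSpectrum (BaseChangeRing R f S),
    PrimeSpectrum.comap (algebraMap (CoordRing R f) (BaseChangeRing R f S)) y = x →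
      IsRegularPoint (B := BaseChangeRing R f S) y

/-- The residue field extension at the maximal ideal `q` of the `R`-algebra `B`, from the residue
ring of `R` at `q ∩ R` to `B / q`, is separable (algebraic). -/
def HasSeparableResidueExt (R : Type*) [CommRing R] {B : Type*} [CommRing B] [Algebra R B]
    (q : Ideal B) : Prop :=
  Algebra.IsSeparable (R ⧸ q.under R) (B ⧸ q)

/-- The extension of Dedekind domains `S / R` is unramified: at every maximal ideal of `S` the
ramification index is `1` and the residue field extension is separable. -/
def IsUnramifiedExt (R S : Type*) [CommRing R] [CommRing S] [Algebra R S] : Prop :=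
  ∀ P : Ideal S, P.IsMaximal → P.ramificationIdx R = 1 ∧ HasSeparableResidueExt R P

/-- The extension of Dedekind domains `S / R` is ramified: some maximal ideal of `S` has
ramification index greater than `1`. -/
def IsRamifiedExt (R S : Type*) [CommRing R] [CommRing S] [Algebra R S] : Prop :=
  ∃ P : Ideal S, P.IsMaximal ∧ 1 < P.ramificationIdx R

section Jacobian

variable {R : Type*} [CommRing R] {n r : ℕ} {f : Fin r → MvPolynomial (Fin n) R}

/-- The residue field `κ(x) = A / 𝔪_x` of a closed point `x` of `X`. -/
abbrev ResField (x : PrimeSpectrum (CoordRing R f)) : Type _ :=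
  CoordRing R f ⧸ x.asIdeal

/-- The value `p(x) ∈ κ(x)` of a polynomial `p ∈ R[t₁, …, tₙ]`. -/
noncomputable def value (x : PrimeSpectrum (CoordRing R f)) : MvPolynomial (Fin n) R →+* ResField x :=
  (Ideal.Quotient.mk x.asIdeal).comp (Ideal.Quotient.mk (Ideal.span (Set.range f)))

/-- `𝔪_x = (g₁, …, gₙ, π)`, as ideals of the polynomial ring `R[t₁, …, tₙ]`. -/
def IsPointIdeal (π : R) (g : Fin n → MvPolynomial (Fin n) R)
    (x : PrimeSpectrum (CoordRing R f)) : Prop :=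
  x.asIdeal.comap (Ideal.Quotient.mk (Ideal.span (Set.range f))) =
    Ideal.span (insert (MvPolynomial.C π) (Set.range g))

/-- The matrix `(∂pᵢ/∂tⱼ (x))` over `κ(x)`. -/
noncomputable def derivMatrix {s : ℕ} (p : Fin s → MvPolynomial (Fin n) R)
    (x : PrimeSpectrum (CoordRing R f)) : Matrix (Fin s) (Fin n) (ResField x) :=
  Matrix.of fun i j => value x (MvPolynomial.pderiv j (p i))

/-- `(J | w)` is the extended Jacobian matrix `(∂fᵢ/∂gⱼ (x) | fᵢ(x)/π)`: there are expansions
`fᵢ = ∑ⱼ hᵢⱼ gⱼ + π cᵢ` in `R[t₁, …, tₙ]` such that `J = (hᵢⱼ(x))` and `w = (cᵢ(x))`. -/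
def IsExtendedJacobian (π : R) (g : Fin n → MvPolynomial (Fin n) R)
    (x : PrimeSpectrum (CoordRing R f))
    (J : Matrix (Fin r) (Fin n) (ResField x)) (w : Fin r → ResField x) : Prop :=
  ∃ (h : Fin r → Fin n → MvPolynomial (Fin n) R) (c : Fin r → MvPolynomial (Fin n) R),
    (∀ i, f i = ∑ j, h i j * g j + MvPolynomial.C π * c i) ∧
    (∀ i j, J i j = value x (h i j)) ∧ ∀ i, w i = value x (c i)

end Jacobian

end ArithJac

namespace ArithJac

open IsLocalRing

/-! Everything is decided by whether `π` lies in `𝔪_x ^ 2`. Let `y` lie over `x` and over `P ⊂ S`,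
with `P = (ϖ)` and `π = ϖ ^ e * u`, `u ∉ P`. Separability on either side makes `κ(x) ⊗ S/P` reduced,
so the maximal ideal at `y` is `I + (ϖ)`, where `I` is the extension of `𝔪_x`. By flatness the
dimension at `y` is at least that at `x`, so regularity follows once that many generators suffice.
If `e = 1`, then `ϖ ∈ I` and generators of `𝔪_x` are enough. If `π ∉ 𝔪_x ^ 2`, then `π` is one of a
minimal system of generators of `𝔪_x`, and `ϖ` replaces it. If `e > 1` and `π ∈ 𝔪_x ^ 2`, then `ϖ ^
e ∈ I ^ 2` while `ϖ ^ (e - 1) ∉ I`, which `not_isRegularLocalRing_of_pow_mem_sq` shows to be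
impossible in a regular ring.

The linear system enters through the polynomial ring: the ideal `M` of `x` there has height `n + 1`,
so `g₁, …, gₙ, π` form a basis of `M / M ^ 2`. Hence `π ∈ 𝔪_x ^ 2` means `π ≡ ∑ uᵢ fᵢ` modulo `M ^
2`; comparing coefficients gives `u J = 0` and `u · w = 1`, which is exactly the obstruction to
solving `J v = w`. The same basis property makes `J` and `w` well defined. -/

theorem sup_span_singleton_pow_two_le {B : Type*} [CommRing B] (J : Ideal B) (a : B) :
    (J ⊔ Ideal.span {a}) ^ 2 ≤ J ⊔ Ideal.span {a ^ 2} := by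
  rw [pow_two, Ideal.mul_le]
  intro x hx y hy
  obtain ⟨u, hu, v, hv, rfl⟩ := Submodule.mem_sup.1 hx
  obtain ⟨u', hu', v', hv', rfl⟩ := Submodule.mem_sup.1 hy
  obtain ⟨c, rfl⟩ := Ideal.mem_span_singleton.1 hv
  obtain ⟨c', rfl⟩ := Ideal.mem_span_singleton.1 hv'
  refine Submodule.mem_sup.2 ⟨u * (u' + a * c') + a * c * u', J.add_mem (J.mul_mem_right _ hu)
    (J.mul_mem_left _ hu'), a ^ 2 * (c * c'), Ideal.mem_span_singleton.2 ⟨_, rfl⟩, by ring⟩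

/-! ### Regularity criteria for Noetherian local rings. -/

section LocalAlgebra

variable {B : Type*} [CommRing B] [IsLocalRing B] [IsNoetherianRing B]

/-- A generator of the maximal ideal outside its square is part of a minimal system of generators
taken from any given generating set. -/
theorem exists_finset_span_insert_eq_maximalIdeal {T : Set B} (hT : Ideal.span T = maximalIdeal B)
    {p : B} (hpT : p ∈ T) (hp : p ∉ maximalIdeal B ^ 2) :
    ∃ s : Finset B, (s : Set B) ⊆ T ∧ s.card + 1 = (maximalIdeal B).spanFinrank ∧
      Ideal.span (insert p (s : Set B)) = maximalIdeal B := by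
  classical
  have hTm : T ⊆ maximalIdeal B := hT ▸ Ideal.subset_span
  let φ : maximalIdeal B → CotangentSpace B := (maximalIdeal B).toCotangent
  let T' : Set (maximalIdeal B) := Subtype.val ⁻¹' T
  let p' : maximalIdeal B := ⟨p, hTm hpT⟩
  have hp0 : φ p' ≠ 0 := fun h => hp ((Ideal.toCotangent_eq_zero _ _).1 h)
  -- Nakayama: generating the maximal ideal is the same as spanning the cotangent space, so the
  -- claim becomes a basis extension from `φ p'`.
  have key : ∀ U : Set (maximalIdeal B), Submodule.span (ResidueField B) (φ '' U) = ⊤ ↔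
      Ideal.span (Subtype.val '' U) = maximalIdeal B := by
    intro U
    rw [CotangentSpace.span_image_eq_top_iff, ← (Submodule.map_injective_of_injective
      (maximalIdeal B).injective_subtype).eq_iff, Submodule.map_span, Submodule.map_top,
      Submodule.range_subtype]
    rfl
  have hspan : Submodule.span (ResidueField B) (φ '' T') = ⊤ := by
    have : Subtype.val '' T' = T :=
      (Subtype.image_preimage_coe _ T).trans (Set.inter_eq_right.2 hTm)
    rw [key, this, hT]
  obtain ⟨b, hbT, hpb, hTb, hli⟩ := exists_linearIndepOn_id_extension
    (K := ResidueField B) (s := {φ p'}) (t := φ '' T') (LinearIndepOn.singleton (v := id) hp0)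
    (by rintro _ rfl; exact ⟨p', hpT, rfl⟩)
  have hbspan : Submodule.span (ResidueField B) b = ⊤ := by
    rw [eq_top_iff, ← hspan]; exact Submodule.span_le.2 hTb
  have hbfin : b.Finite := hli.linearIndependent.setFinite
  obtain ⟨F, rfl⟩ := hbfin.exists_finset_coe
  have hcard : F.card = (maximalIdeal B).spanFinrank := by
    rw [spanFinrank_maximalIdeal_eq_finrank_cotangentSpace]
    rw [← finrank_top (ResidueField B) (CotangentSpace B), ← hbspan]
    exact (finrank_span_finset_eq_card hli).symm
  have hex : ∀ z ∈ F, ∃ a ∈ T', φ a = z := fun z hz => hbT hz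
  choose! ψ hψT hψ using hex
  refine ⟨((F.erase (φ p')).image ψ).image Subtype.val, ?_, ?_, ?_⟩
  · intro z hz
    simp only [Finset.coe_image, Set.mem_image] at hz
    obtain ⟨_, ⟨c, hc, rfl⟩, rfl⟩ := hz
    exact hψT _ (Finset.mem_of_mem_erase hc)
  · rw [Finset.card_image_of_injective _ Subtype.val_injective, Finset.card_image_of_injOn,
      Finset.card_erase_add_one (by simpa using hpb), hcard]
    intro c hc c' hc' h
    rw [← hψ c (Finset.mem_of_mem_erase hc), ← hψ c' (Finset.mem_of_mem_erase hc'), h]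
  · have : insert p ((((F.erase (φ p')).image ψ).image Subtype.val : Finset B) : Set B) =
        Subtype.val '' (insert p' (ψ '' (F.erase (φ p') : Set (CotangentSpace B)))) := by
      simp [Set.image_insert_eq, p']
    rw [this, ← key, Set.image_insert_eq, Set.image_image, eq_top_iff, ← hbspan,
      Submodule.span_le]
    intro z hz
    apply Submodule.subset_span
    by_cases h : z = φ p'
    · exact Or.inl h
    · exact Or.inr ⟨z, by simpa using ⟨hz, h⟩, hψ z hz⟩

/-- If the maximal ideal is generated by `I` and `ϖ`, where `ϖ` has order at least `k + 1 ≥ 2`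
modulo `I` but `ϖ ^ (k + 1) ∈ I ^ 2`, then the ring is not regular. -/
theorem not_isRegularLocalRing_of_pow_mem_sq {I : Ideal B} {ϖ : B} {k : ℕ} (hk : k ≠ 0)
    (hm : I ⊔ Ideal.span {ϖ} = maximalIdeal B) (hϖ : ϖ ^ k ∉ I) (hϖ' : ϖ ^ (k + 1) ∈ I ^ 2) :
    ¬ IsRegularLocalRing B := by
  intro hreg
  have hϖm : ϖ ∈ maximalIdeal B := hm ▸ Ideal.mem_sup_right (Ideal.mem_span_singleton_self ϖ)
  have hIm : I ≤ maximalIdeal B := hm ▸ le_sup_left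
  have hϖ2 : ϖ ∉ maximalIdeal B ^ 2 := by
    intro h
    have hle : maximalIdeal B ≤ I := by
      refine Submodule.le_of_le_smul_of_le_jacobson_bot (IsNoetherian.noetherian _)
        (maximalIdeal_le_jacobson _) ?_ (I := maximalIdeal B)
      rw [smul_eq_mul, ← pow_two]
      calc maximalIdeal B = I ⊔ Ideal.span {ϖ} := hm.symm
        _ ≤ I ⊔ maximalIdeal B ^ 2 :=
          sup_le_sup_left ((Ideal.span_singleton_le_iff_mem _).2 h) _
    exact hϖ (I.pow_mem_of_mem (hle hϖm) k (Nat.pos_of_ne_zero hk))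
  obtain ⟨s, hsT, hcard, hspan⟩ := exists_finset_span_insert_eq_maximalIdeal
    (T := insert ϖ (I : Set B)) (p := ϖ)
    (by rw [Ideal.span_insert, Ideal.span_eq, sup_comm, hm]) (Set.mem_insert _ _) hϖ2
  -- The intersection with `I` discards `ϖ`, which may occur in `s` without lying in `I`.
  set J : Ideal B := Ideal.span ((s : Set B) ∩ I) with hJ
  have hJI : J ≤ I := Ideal.span_le.2 Set.inter_subset_right
  have hmJ : maximalIdeal B = J ⊔ Ideal.span {ϖ} := by
    refine le_antisymm ?_ (sup_le (hJI.trans hIm) ((Ideal.span_singleton_le_iff_mem _).2 hϖm))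
    rw [← hspan, Ideal.span_le]
    rintro z (rfl | hz)
    · exact Ideal.mem_sup_right (Ideal.mem_span_singleton_self _)
    · rcases hsT hz with rfl | hzI
      · exact Ideal.mem_sup_right (Ideal.mem_span_singleton_self _)
      · exact Ideal.mem_sup_left (Ideal.subset_span ⟨hz, hzI⟩)
  -- Write an element of `I` as `a + ϖ ^ i * c` with `a ∈ J`. As long as `i ≤ k`, a unit `c` would
  -- put `ϖ ^ k` in `I`; so `c ∈ J + (ϖ)` and the exponent goes up by one.
  have hind : ∀ i ≤ k + 1, I ≤ J ⊔ Ideal.span {ϖ ^ i} := by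
    intro i
    induction i with
    | zero => intro _; simp
    | succ i ih =>
      intro hi z hz
      obtain ⟨a, ha, b, hb, rfl⟩ := Submodule.mem_sup.1 (ih (by omega) hz)
      obtain ⟨c, rfl⟩ := Ideal.mem_span_singleton.1 hb
      have hc : c ∈ maximalIdeal B := by
        rw [mem_maximalIdeal, mem_nonunits_iff]
        intro hu
        apply hϖ
        have h1 : ϖ ^ i * c ∈ I := by simpa using I.sub_mem hz (hJI ha)
        have h2 : ϖ ^ i ∈ I := (Ideal.mul_unit_mem_iff_mem I hu).1 h1
        exact I.mem_of_dvd (pow_dvd_pow _ (by omega)) h2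
      rw [hmJ] at hc
      obtain ⟨a', ha', b', hb', rfl⟩ := Submodule.mem_sup.1 hc
      obtain ⟨c', rfl⟩ := Ideal.mem_span_singleton.1 hb'
      refine Submodule.mem_sup.2 ⟨a + ϖ ^ i * a', J.add_mem ha (J.mul_mem_left _ ha'),
        ϖ ^ (i + 1) * c', Ideal.mem_span_singleton.2 ⟨c', rfl⟩, by ring⟩
  -- Squaring the last inclusion gives `ϖ ^ (k + 1) ∈ J + (ϖ ^ (2 * (k + 1)))`, and the factor `1 -
  -- ϖ ^ (k + 1) * c` is a unit.
  have hpowJ : ϖ ^ (k + 1) ∈ J := by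
    have h1 : ϖ ^ (k + 1) ∈ J ⊔ Ideal.span {(ϖ ^ (k + 1)) ^ 2} :=
      sup_span_singleton_pow_two_le J _ (Ideal.pow_right_mono (hind (k + 1) le_rfl) 2 hϖ')
    clear_value J
    obtain ⟨a, ha, b, hb, h⟩ := Submodule.mem_sup.1 h1
    obtain ⟨c, rfl⟩ := Ideal.mem_span_singleton.1 hb
    have hu : IsUnit (1 - ϖ ^ (k + 1) * c) := by
      by_contra hnu
      have h4 : ϖ ^ (k + 1) * c ∈ maximalIdeal B :=
        Ideal.mul_mem_right _ _ (Ideal.pow_mem_of_mem _ hϖm _ (Nat.succ_pos _))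
      have h5 := (maximalIdeal B).add_mem ((mem_maximalIdeal _).2 hnu) h4
      rw [sub_add_cancel] at h5
      exact (maximalIdeal.isMaximal B).ne_top ((Ideal.eq_top_iff_one _).2 h5)
    refine (Ideal.mul_unit_mem_iff_mem J hu).1 ?_
    convert ha using 1
    linear_combination -h
  classical
  -- The maximal ideal is thus minimal over an ideal with at most `s.card` generators, one fewer
  -- than the dimension, against Krull's height theorem.
  have hmin : maximalIdeal B ∈
      (Ideal.span ((s.filter (· ∈ I) : Finset B) : Set B)).minimalPrimes := by
    have hsJ : Ideal.span ((s.filter (· ∈ I) : Finset B) : Set B) = J := by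
      rw [hJ]; congr 1; ext; simp
    rw [hsJ]
    refine ⟨⟨inferInstance, hJI.trans hIm⟩, fun Q ⟨hQ, hJQ⟩ _ => ?_⟩
    rw [hmJ]
    exact sup_le hJQ ((Ideal.span_singleton_le_iff_mem _).2 (hQ.mem_of_pow_mem _ (hJQ hpowJ)))
  have hht := Ideal.height_le_card_of_mem_minimalPrimes_span_finset hmin
  have hle : (s.filter (· ∈ I)).card ≤ s.card := Finset.card_filter_le _ _
  have hdim := hreg.spanFinrank_maximalIdeal
  rw [← maximalIdeal_height_eq_ringKrullDim, ← hcard] at hdim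
  have : (maximalIdeal B).height = (s.card + 1 : ℕ) := by exact_mod_cast hdim.symm
  rw [this] at hht
  have : s.card + 1 ≤ (s.filter (· ∈ I)).card := by exact_mod_cast hht
  omega

theorem isRegularLocalRing_of_span_finset {s : Finset B}
    (hs : Ideal.span (s : Set B) = maximalIdeal B) (hd : (s.card : WithBot ℕ∞) ≤ ringKrullDim B) :
    IsRegularLocalRing B := by
  refine .of_spanFinrank_maximalIdeal_le B (le_trans ?_ hd)
  have h := Submodule.spanFinrank_span_le_ncard_of_finite (R := B) s.finite_toSet
  rw [Set.ncard_coe_finset] at h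
  rw [← hs]
  exact_mod_cast h

end LocalAlgebra

/-! ### Primes and extended ideals in `A ⊗[R] S`. -/

section Fiber

variable {R A S : Type*} [CommRing R] [CommRing A] [CommRing S] [Algebra R A] [Algebra R S]

open Algebra.TensorProduct in
-- Unramifiedness passes to `A ⊗ S/P` over `A`, where a maximal ideal of `A` extends to a radical
-- ideal; pulling back along `A ⊗ S → A ⊗ S/P` adds the kernel, which is the extension of `P`.
theorem isRadical_map_sup_map_of_formallyUnramified (p : Ideal A) [p.IsMaximal] (P : Ideal S)
    [Algebra.EssFiniteType R (S ⧸ P)] [Algebra.FormallyUnramified R (S ⧸ P)] :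
    (p.map (algebraMap A (A ⊗[R] S)) ⊔
      P.map (includeRight : S →ₐ[R] A ⊗[R] S).toRingHom).IsRadical := by
  let φ : A ⊗[R] S →ₐ[A] A ⊗[R] (S ⧸ P) :=
    Algebra.TensorProduct.map (AlgHom.id A A) (Ideal.Quotient.mkₐ R P)
  have hφ : Function.Surjective φ.toRingHom :=
    Algebra.TensorProduct.map_surjective (AlgHom.id A A) (Ideal.Quotient.mkₐ R P)
      Function.surjective_id Ideal.Quotient.mk_surjective
  have hker : RingHom.ker φ.toRingHom = P.map (includeRight : S →ₐ[R] A ⊗[R] S).toRingHom := by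
    have h := lTensor_ker (A := A) (Ideal.Quotient.mkₐ R P) Ideal.Quotient.mk_surjective
    have hP : RingHom.ker (Ideal.Quotient.mkₐ R P) = P := Ideal.Quotient.mkₐ_ker R P
    rw [hP] at h
    exact h
  have hmap : (p.map (algebraMap A (A ⊗[R] S))).map φ.toRingHom =
      p.map (algebraMap A (A ⊗[R] (S ⧸ P))) := by
    rw [Ideal.map_map]
    congr 1
  have hrad := Algebra.FormallyUnramified.isRadical_map_isMaximal (A := A) (A ⊗[R] (S ⧸ P)) p
  rw [← hmap] at hrad
  have := hrad.comap φ.toRingHom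
  rwa [Ideal.comap_map_of_surjective' _ hφ, hker] at this

open Algebra.TensorProduct in
theorem isRadical_map_sup_map_of_formallyUnramified' (p : Ideal A) (P : Ideal S) [P.IsMaximal]
    [Algebra.EssFiniteType R (A ⧸ p)] [Algebra.FormallyUnramified R (A ⧸ p)] :
    (p.map (algebraMap A (A ⊗[R] S)) ⊔
      P.map (includeRight : S →ₐ[R] A ⊗[R] S).toRingHom).IsRadical := by
  have h := isRadical_map_sup_map_of_formallyUnramified (R := R) P p
  let e := (Algebra.TensorProduct.comm R A S).toRingHom
  let e' := (Algebra.TensorProduct.comm R S A).toRingHom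
  have hee' : ∀ z, e' (e z) = z := (Algebra.TensorProduct.comm R A S).symm_apply_apply
  rintro z ⟨n, hn⟩
  have h1 : e z ∈ P.map (algebraMap S (S ⊗[R] A)) ⊔
      p.map (includeRight : A →ₐ[R] S ⊗[R] A).toRingHom := by
    refine h ⟨n, ?_⟩
    have h2 := Ideal.mem_map_of_mem e hn
    rw [Ideal.map_sup, Ideal.map_map, Ideal.map_map, sup_comm, map_pow] at h2
    exact h2
  have h3 := Ideal.mem_map_of_mem e' h1
  rw [hee', Ideal.map_sup, Ideal.map_map, Ideal.map_map, sup_comm] at h3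
  exact h3

theorem formallyUnramified_quotient {p : Ideal A} [p.IsMaximal]
    (hp : (p.under R).IsMaximal) (h : HasSeparableResidueExt R p) :
    Algebra.FormallyUnramified R (A ⧸ p) := by
  let : Field (R ⧸ p.under R) := Ideal.Quotient.field _
  let : Field (A ⧸ p) := Ideal.Quotient.field _
  have : Algebra.IsSeparable (R ⧸ p.under R) (A ⧸ p) := h
  have : Algebra.FormallyUnramified (R ⧸ p.under R) (A ⧸ p) :=
    Algebra.FormallyUnramified.of_isSeparable _ _
  exact .comp R (R ⧸ p.under R) (A ⧸ p)

end Fiber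

/-- A generalized inverse, used in `mem_of_mul_mem_map` to divide by a zero divisor of `S / qS`. -/
theorem exists_linearMap_comp_comp_eq {k M N : Type*} [Field k] [AddCommGroup M] [Module k M]
    [AddCommGroup N] [Module k N] (T : M →ₗ[k] N) : ∃ T' : N →ₗ[k] M, T ∘ₗ T' ∘ₗ T = T := by
  obtain ⟨g, hg⟩ := T.rangeRestrict.exists_rightInverse_of_surjective T.range_rangeRestrict
  obtain ⟨T', hT'⟩ := LinearMap.exists_extend g
  refine ⟨T', LinearMap.ext fun m => ?_⟩
  have h1 : T' (T m) = g (T.rangeRestrict m) := LinearMap.congr_fun hT' (T.rangeRestrict m)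
  have h2 := congrArg Subtype.val (LinearMap.congr_fun hg (T.rangeRestrict m))
  simp only [LinearMap.comp_apply]
  rw [h1]
  exact h2

section Fiber

variable {R A S : Type*} [CommRing R] [CommRing A] [CommRing S] [Algebra R A] [Algebra R S]

/-- Since `A ⊗ S` is integral over `A`, all primes containing `c` are maximal. So `y` is minimal
over `c`, and a radical ideal localizes at a minimal prime to the maximal ideal. -/
theorem map_eq_maximalIdeal_of_isRadical [Module.Finite R S] [IsNoetherianRing A]
    {c : Ideal (A ⊗[R] S)} (hc : c.IsRadical) (y : Ideal (A ⊗[R] S)) [y.IsPrime] (hcy : c ≤ y)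
    (hmax : (c.comap (algebraMap A (A ⊗[R] S))).IsMaximal) :
    c.map (algebraMap _ (Localization.AtPrime y)) = maximalIdeal (Localization.AtPrime y) := by
  have hy : y ∈ c.minimalPrimes := by
    refine ⟨⟨inferInstance, hcy⟩, fun Q ⟨hQ, hcQ⟩ hQy => ?_⟩
    have hQmax : Q.IsMaximal := by
      apply Ideal.isMaximal_of_isIntegral_of_isMaximal_comap (R := A) Q
      rwa [← hmax.eq_of_le (Ideal.comap_ne_top _ hQ.ne_top) (Ideal.comap_mono hcQ)]
    exact (hQmax.eq_of_le (Ideal.IsPrime.ne_top inferInstance) hQy).ge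
  have h := IsLocalization.AtPrime.radical_map_of_mem_minimalPrimes (Localization.AtPrime y) y c hy
  rw [← IsLocalization.map_radical y.primeCompl, hc.radical,
    Localization.AtPrime.map_eq_maximalIdeal] at h
  exact h

theorem ringKrullDim_le_of_comap_eq {B : Type*} [CommRing B] [Algebra A B] [Module.Flat A B]
    [IsNoetherianRing B] [IsNoetherianRing A] (p : Ideal A) [p.IsPrime] (y : Ideal B) [y.IsPrime]
    (h : y.comap (algebraMap A B) = p) :
    ringKrullDim (Localization.AtPrime p) ≤ ringKrullDim (Localization.AtPrime y) := by
  have : y.LiesOver p := ⟨h.symm⟩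
  rw [IsLocalization.AtPrime.ringKrullDim_eq_height p,
    IsLocalization.AtPrime.ringKrullDim_eq_height y,
    Ideal.height_eq_height_add_of_liesOver_of_hasGoingDown p y]
  exact_mod_cast le_self_add

open Algebra.TensorProduct in
-- Serves to show `ϖ ^ (e - 1) ∉ I`. A generalized inverse of multiplication by `a` on `S / qS`
-- yields an `A`-linear `Ψ` into `(A ⊗ S) / y` with `Ψ (b * a) = b`: the ambiguity in dividing by
-- `a` lies in `P`, hence dies modulo `y`. As `Ψ` kills the extension of `p`, so does the class of
-- `t` vanish.
theorem mem_of_mul_mem_map {q : Ideal R} [q.IsMaximal] {p : Ideal A}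
    {P : Ideal S} {a : S} (ha : ∀ s, a * s ∈ q.map (algebraMap R S) → s ∈ P)
    (y : Ideal (A ⊗[R] S))
    (hyp : p ≤ y.comap (algebraMap A (A ⊗[R] S))) (hqp : q ≤ p.comap (algebraMap R A))
    (hyP : P ≤ y.comap (includeRight : S →ₐ[R] A ⊗[R] S))
    {t : A ⊗[R] S} (ht : t * (includeRight : S →ₐ[R] A ⊗[R] S) a ∈ p.map (algebraMap A (A ⊗[R] S))) :
    t ∈ y := by
  let _ : Field (R ⧸ q) := Ideal.Quotient.field q
  let M := S ⧸ q.map (algebraMap R S)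
  let T : M →ₗ[R ⧸ q] M := LinearMap.mulLeft (R ⧸ q) (Ideal.Quotient.mk _ a)
  obtain ⟨T', hT'⟩ := exists_linearMap_comp_comp_eq T
  have hqy : q.map (algebraMap R S) ≤ y.comap (includeRight : S →ₐ[R] A ⊗[R] S) := by
    rw [Ideal.map_le_iff_le_comap]
    intro r hr
    have h1 : algebraMap A (A ⊗[R] S) (algebraMap R A r) ∈ y := hyp (hqp hr)
    rw [Ideal.mem_comap, Ideal.mem_comap, AlgHom.commutes]
    rwa [← IsScalarTower.algebraMap_apply R A (A ⊗[R] S)] at h1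
  let u : M →ₐ[R] (A ⊗[R] S) ⧸ y := Ideal.quotientMapₐ y includeRight hqy
  let σ : S →ₗ[R] (A ⊗[R] S) ⧸ y := u.toLinearMap ∘ₗ T'.restrictScalars R ∘ₗ
    (Ideal.Quotient.mkₐ R (q.map (algebraMap R S))).toLinearMap
  have hσ : ∀ s, σ (a * s) = Ideal.Quotient.mk y ((includeRight : S →ₐ[R] A ⊗[R] S) s) := by
    intro s
    obtain ⟨s', hs'⟩ := Ideal.Quotient.mk_surjective (T' (T (Ideal.Quotient.mk _ s)))
    have h1 : σ (a * s) = u (T' (T (Ideal.Quotient.mk _ s))) := rfl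
    have h2 : T (T' (T (Ideal.Quotient.mk _ s))) = T (Ideal.Quotient.mk _ s) :=
      LinearMap.congr_fun hT' _
    rw [h1, ← hs']
    rw [← hs'] at h2
    have h3 : Ideal.Quotient.mk (q.map (algebraMap R S)) (a * s') =
      Ideal.Quotient.mk (q.map (algebraMap R S)) (a * s) := by simpa [T] using h2
    rw [Ideal.Quotient.mk_eq_mk_iff_sub_mem, ← mul_sub] at h3
    have h4 := hyP (ha _ h3)
    change Ideal.Quotient.mk y _ = _
    rw [Ideal.Quotient.mk_eq_mk_iff_sub_mem]
    rw [Ideal.mem_comap, map_sub] at h4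
    exact h4
  let Ψ : A ⊗[R] S →ₗ[A] (A ⊗[R] S) ⧸ y := TensorProduct.AlgebraTensorModule.lift
    ((LinearMap.toSpanSingleton A (S →ₗ[R] (A ⊗[R] S) ⧸ y) σ))
  have hΨ : ∀ b : A ⊗[R] S, Ψ (b * (includeRight : S →ₐ[R] A ⊗[R] S) a) = Ideal.Quotient.mk y b := by
    intro b
    induction b using TensorProduct.induction_on with
    | zero => simp
    | add b c hb hc => rw [add_mul, map_add, hb, hc, map_add]
    | tmul b s =>
      have : Ψ (b ⊗ₜ (s * a)) = b • σ (s * a) := rfl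
      rw [includeRight_apply, tmul_mul_tmul, mul_one, this, mul_comm, hσ]
      change Ideal.Quotient.mk y (b • (1 ⊗ₜ[R] s)) = _
      rw [TensorProduct.smul_tmul', smul_eq_mul, mul_one]
  have hΨp : ∀ b ∈ p.map (algebraMap A (A ⊗[R] S)), Ψ b = 0 := by
    intro b hb
    have hb' : b ∈ (p.map (algebraMap A (A ⊗[R] S))).restrictScalars A := hb
    rw [← Ideal.smul_top_eq_map] at hb'
    clear hb
    induction hb' using Submodule.smul_induction_on' with
    | smul c hc b hb =>
      obtain ⟨z, hz⟩ := Ideal.Quotient.mk_surjective (Ψ b)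
      rw [map_smul, ← hz, ← Ideal.Quotient.mkₐ_eq_mk A, ← map_smul, Ideal.Quotient.mkₐ_eq_mk,
        Ideal.Quotient.eq_zero_iff_mem, Algebra.smul_def]
      exact y.mul_mem_right _ (hyp hc)
    | add b hb c hc ihb ihc =>
      rw [map_add, ihb, ihc, add_zero]
  rw [← Ideal.Quotient.eq_zero_iff_mem, ← hΨ, hΨp _ ht]

open Algebra.TensorProduct in
theorem notMem_map_localization {q : Ideal R} [q.IsMaximal] {p : Ideal A}
    {P : Ideal S} {a : S} (ha : ∀ s, a * s ∈ q.map (algebraMap R S) → s ∈ P)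
    (y : Ideal (A ⊗[R] S)) [y.IsPrime]
    (hyp : p ≤ y.comap (algebraMap A (A ⊗[R] S))) (hqp : q ≤ p.comap (algebraMap R A))
    (hyP : P ≤ y.comap (includeRight : S →ₐ[R] A ⊗[R] S)) :
    algebraMap (A ⊗[R] S) (Localization.AtPrime y) ((includeRight : S →ₐ[R] A ⊗[R] S) a) ∉
      (p.map (algebraMap A (A ⊗[R] S))).map (algebraMap _ (Localization.AtPrime y)) := by
  intro h
  rw [IsLocalization.algebraMap_mem_map_algebraMap_iff y.primeCompl] at h
  obtain ⟨t, ht, h⟩ := h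
  exact ht (mem_of_mul_mem_map ha y hyp hqp hyP h)

/-- A tensor product of two residue fields over `R / q` is nonzero; pull back one of its maximal
ideals. -/
theorem exists_prime_tensorProduct (q : Ideal R) [q.IsMaximal] (p : Ideal A) [p.IsMaximal]
    (P : Ideal S) [P.IsMaximal] [p.LiesOver q] [P.LiesOver q] :
    ∃ y : PrimeSpectrum (A ⊗[R] S), y.asIdeal.comap (algebraMap A (A ⊗[R] S)) = p ∧
      y.asIdeal.comap (Algebra.TensorProduct.includeRight : S →ₐ[R] A ⊗[R] S) = P := by
  let _ : Field (R ⧸ q) := Ideal.Quotient.field q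
  let f : A →ₐ[R] (A ⧸ p) ⊗[R ⧸ q] (S ⧸ P) :=
    (IsScalarTower.toAlgHom R (A ⧸ p) _).comp (Ideal.Quotient.mkₐ R p)
  let g : S →ₐ[R] (A ⧸ p) ⊗[R ⧸ q] (S ⧸ P) :=
    ((Algebra.TensorProduct.includeRight : (S ⧸ P) →ₐ[R ⧸ q] _).restrictScalars R).comp
      (Ideal.Quotient.mkₐ R P)
  let F : A ⊗[R] S →ₐ[R] (A ⧸ p) ⊗[R ⧸ q] (S ⧸ P) :=
    Algebra.TensorProduct.lift f g (fun _ _ => .all _ _)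
  have : Nontrivial ((A ⧸ p) ⊗[R ⧸ q] (S ⧸ P)) :=
    (Module.FaithfullyFlat.nontrivial_tensorProduct_iff_right (R ⧸ q) (A ⧸ p)).2 inferInstance
  obtain ⟨z, hz⟩ := Ideal.exists_maximal ((A ⧸ p) ⊗[R ⧸ q] (S ⧸ P))
  have := hz.isPrime
  refine ⟨⟨z.comap F, inferInstance⟩, ?_, ?_⟩
  · refine (Ideal.IsMaximal.eq_of_le ‹p.IsMaximal› (Ideal.comap_ne_top _
      (Ideal.comap_ne_top _ hz.ne_top)) ?_).symm
    intro a ha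
    have : F (algebraMap A _ a) = 0 := by
      have h1 : F (algebraMap A _ a) = f a * g 1 := Algebra.TensorProduct.lift_tmul _ _ _ a 1
      have h2 : f a = algebraMap (A ⧸ p) _ (Ideal.Quotient.mk p a) := rfl
      rw [h1, h2, Ideal.Quotient.eq_zero_iff_mem.2 ha, map_zero, zero_mul]
    change F (algebraMap A _ a) ∈ z
    rw [this]; exact z.zero_mem
  · refine (Ideal.IsMaximal.eq_of_le ‹P.IsMaximal› (Ideal.comap_ne_top _
      (Ideal.comap_ne_top _ hz.ne_top)) ?_).symm
    intro a ha
    have : F (Algebra.TensorProduct.includeRight a) = 0 := by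
      have h1 : F (Algebra.TensorProduct.includeRight a) = f 1 * g a :=
        Algebra.TensorProduct.lift_tmul _ _ _ 1 a
      have h2 : g a = Algebra.TensorProduct.includeRight (R := R ⧸ q) (A := A ⧸ p)
        (Ideal.Quotient.mk P a) := rfl
      rw [h1, h2, Ideal.Quotient.eq_zero_iff_mem.2 ha, map_zero, mul_zero]
    change F (Algebra.TensorProduct.includeRight a) ∈ z
    rw [this]; exact z.zero_mem

end Fiber

/-! ### Uniformizers of the semilocal ring `S`. -/

section Ramification

theorem isPrincipalIdealRing_of_finite (R S : Type*) [CommRing R] [IsDomain R]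
    [IsDiscreteValuationRing R] [CommRing S] [Algebra R S] [IsDedekindDomain S] [Module.Finite R S]
    [FaithfulSMul R S] : IsPrincipalIdealRing S := by
  refine IsPrincipalIdealRing.of_finite_maximals ?_
  refine (IsDedekindDomain.primesOver_finite (maximalIdeal R) S).subset fun P hP => ?_
  have : P.IsMaximal := hP
  exact ⟨hP.isPrime, ⟨(IsLocalRing.eq_maximalIdeal
    (Ideal.isMaximal_comap_of_isIntegral_of_isMaximal P)).symm⟩⟩

variable {R S : Type*} [CommRing R] [IsDomain R] [IsDiscreteValuationRing R] [CommRing S]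
  [Algebra R S] [IsDedekindDomain S] [Module.Finite R S] [FaithfulSMul R S]

/-- The cofactor `u` need not be a unit of `S`, since `π` lies in every maximal ideal; it becomes
one in the local ring at any `y` over `P`. -/
theorem exists_uniformizer {π : R} (hπ : Irreducible π) (P : Ideal S) [P.IsMaximal] :
    ∃ ϖ u : S, P = Ideal.span {ϖ} ∧ u ∉ P ∧
      algebraMap R S π = ϖ ^ P.ramificationIdx R * u ∧ P.ramificationIdx R ≠ 0 := by
  have := isPrincipalIdealRing_of_finite R S
  have hlies : P.LiesOver (maximalIdeal R) := ⟨(IsLocalRing.eq_maximalIdeal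
    (Ideal.isMaximal_comap_of_isIntegral_of_isMaximal P)).symm⟩
  obtain ⟨ϖ, rfl⟩ := IsPrincipalIdealRing.principal P
  rw [← Ideal.span] at *
  have hm : maximalIdeal R = Ideal.span {π} := hπ.maximalIdeal_eq
  have hm0 : maximalIdeal R ≠ ⊥ := IsDiscreteValuationRing.not_a_field R
  have he : (maximalIdeal R).ramificationIdx' (Ideal.span {ϖ}) =
    (Ideal.span {ϖ}).ramificationIdx R := Ideal.ramificationIdx'_eq_ramificationIdx _ _ hm0
  set e := (Ideal.span {ϖ}).ramificationIdx R
  have he0 : e ≠ 0 := (Ideal.ramificationIdx_pos _ R).ne'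
  have h1 : (maximalIdeal R).map (algebraMap R S) ≤ (Ideal.span {ϖ}) ^ e := by
    rw [← he]; exact Ideal.le_pow_ramificationIdx'
  have h2 : ¬ (maximalIdeal R).map (algebraMap R S) ≤ (Ideal.span {ϖ}) ^ (e + 1) := by
    have hmap : (maximalIdeal R).map (algebraMap R S) ≠ ⊥ := Ideal.map_ne_bot_of_ne_bot hm0
    have hprime : (Ideal.span {ϖ}).IsPrime := Ideal.IsMaximal.isPrime ‹_›
    rw [← Ideal.dvd_iff_le]
    refine (FiniteMultiplicity.of_not_isUnit ?_ hmap).not_pow_dvd_of_multiplicity_lt ?_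
    · rw [Ideal.isUnit_iff]; exact hprime.ne_top
    · rw [← Ideal.IsDedekindDomain.ramificationIdx_eq_multiplicity (maximalIdeal R) _ hmap]
      exact Nat.lt_succ_self _
  rw [hm, Ideal.map_span, Set.image_singleton, Ideal.span_singleton_pow,
    Ideal.span_singleton_le_iff_mem, Ideal.mem_span_singleton] at h1 h2
  obtain ⟨u, hu⟩ := h1
  refine ⟨ϖ, u, rfl, fun h => h2 ?_, hu, he0⟩
  obtain ⟨v, rfl⟩ := Ideal.mem_span_singleton.1 h
  exact ⟨v, by rw [hu]; ring⟩

theorem mem_of_pow_mul_mem_span {ϖ u p : S} {k : ℕ} (hϖ : ϖ ≠ 0)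
    (hp : p = ϖ ^ (k + 1) * u) (s : S)
    (hs : ϖ ^ k * s ∈ Ideal.span {p}) : s ∈ Ideal.span {ϖ} := by
  obtain ⟨c, hc⟩ := Ideal.mem_span_singleton.1 hs
  rw [hp, pow_succ, mul_assoc, mul_assoc] at hc
  exact Ideal.mem_span_singleton.2 ⟨_, mul_left_cancel₀ (pow_ne_zero k hϖ) hc⟩

end Ramification

/-! ### Regularity of the points of `A ⊗[R] S` over a given point. -/

section FiberRegularity

variable {R A S : Type*} [CommRing R] [CommRing A] [Algebra R A] [CommRing S] [Algebra R S]

/-- The second projection `S → A ⊗[R] S` followed by localization at `y`. -/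
noncomputable def includeRightLocalization (y : Ideal (A ⊗[R] S)) [y.IsPrime] :
    S →+* Localization.AtPrime y :=
  (algebraMap (A ⊗[R] S) (Localization.AtPrime y)).comp
    (Algebra.TensorProduct.includeRight : S →ₐ[R] A ⊗[R] S).toRingHom

theorem localRingHom_algebraMap_eq_includeRightLocalization (p : Ideal A) [p.IsPrime]
    (y : Ideal (A ⊗[R] S)) [y.IsPrime] (h : p = y.comap (algebraMap A (A ⊗[R] S))) (a : R) :
    Localization.localRingHom p y (algebraMap A (A ⊗[R] S)) h
      (algebraMap A (Localization.AtPrime p) (algebraMap R A a)) =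
    includeRightLocalization y (algebraMap R S a) := by
  rw [Localization.localRingHom_to_map]
  change _ = algebraMap (A ⊗[R] S) (Localization.AtPrime y)
    ((Algebra.TensorProduct.includeRight : S →ₐ[R] A ⊗[R] S) (algebraMap R S a))
  rw [AlgHom.commutes, ← IsScalarTower.algebraMap_apply R A (A ⊗[R] S)]

theorem isUnit_includeRightLocalization (y : Ideal (A ⊗[R] S)) [y.IsPrime] {u : S}
    (hu : u ∉ y.comap (Algebra.TensorProduct.includeRight : S →ₐ[R] A ⊗[R] S)) :
    IsUnit (includeRightLocalization y u) :=
  IsLocalization.map_units (Localization.AtPrime y)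
    (⟨_, hu⟩ : y.primeCompl)

theorem under_eq_maximalIdeal_of_mem [IsDomain R] [IsDiscreteValuationRing R] {π : R}
    (hπ : Irreducible π) (p : Ideal A) [p.IsPrime]
    (h : algebraMap R A π ∈ p) : p.under R = maximalIdeal R := by
  refine ((maximalIdeal.isMaximal R).eq_of_le (Ideal.comap_ne_top _ ?_) ?_).symm
  · exact Ideal.IsPrime.ne_top ‹_›
  · rw [hπ.maximalIdeal_eq, Ideal.span_singleton_le_iff_mem]; exact h

theorem map_localRingHom_maximalIdeal {B : Type*} [CommRing B] [Algebra A B] (p : Ideal A)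
    [p.IsPrime] (y : Ideal B) [y.IsPrime] (h : p = y.comap (algebraMap A B)) :
    (maximalIdeal (Localization.AtPrime p)).map (Localization.localRingHom p y (algebraMap A B) h) =
      (p.map (algebraMap A B)).map (algebraMap B (Localization.AtPrime y)) := by
  rw [← Localization.AtPrime.map_eq_maximalIdeal, Ideal.map_map, Ideal.map_map]
  congr 1
  ext a
  simp [Localization.localRingHom_to_map]

variable [IsDomain R] [IsDiscreteValuationRing R] [Algebra.FiniteType R A]
  [Module.Finite R S]

theorem map_sup_span_uniformizer_eq_maximalIdeal (p : Ideal A) [hp : p.IsMaximal]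
    (y : Ideal (A ⊗[R] S)) [y.IsPrime] (h : p = y.comap (algebraMap A (A ⊗[R] S)))
    (P : Ideal S) [P.IsMaximal]
    (hP : P = y.comap (Algebra.TensorProduct.includeRight : S →ₐ[R] A ⊗[R] S))
    (hpR : (p.under R).IsMaximal)
    (hsep : HasSeparableResidueExt R p ∨ HasSeparableResidueExt R P)
    {ϖ : S} (hϖ : P = Ideal.span {ϖ}) :
    (maximalIdeal (Localization.AtPrime p)).map
      (Localization.localRingHom p y (algebraMap A (A ⊗[R] S)) h) ⊔
      Ideal.span {includeRightLocalization y ϖ} = maximalIdeal (Localization.AtPrime y) := by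
  have hrad : (p.map (algebraMap A (A ⊗[R] S)) ⊔
      P.map (Algebra.TensorProduct.includeRight : S →ₐ[R] A ⊗[R] S).toRingHom).IsRadical := by
    rcases hsep with hs | hs
    · have := formallyUnramified_quotient hpR hs
      have : Algebra.FiniteType R (A ⧸ p) :=
        .of_surjective (Ideal.Quotient.mkₐ R p) Ideal.Quotient.mk_surjective
      exact isRadical_map_sup_map_of_formallyUnramified' p P
    · have := formallyUnramified_quotient
        (Ideal.isMaximal_comap_of_isIntegral_of_isMaximal (R := R) P) hs
      exact isRadical_map_sup_map_of_formallyUnramified p P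
  have hle : p.map (algebraMap A (A ⊗[R] S)) ⊔
      P.map (Algebra.TensorProduct.includeRight : S →ₐ[R] A ⊗[R] S).toRingHom ≤ y :=
    sup_le (Ideal.map_le_iff_le_comap.2 h.le) (Ideal.map_le_iff_le_comap.2 hP.le)
  have : IsNoetherianRing A := Algebra.FiniteType.isNoetherianRing R A
  have hmax := map_eq_maximalIdeal_of_isRadical hrad y hle (by
    rwa [← hp.eq_of_le (Ideal.comap_ne_top _ fun ht => Ideal.IsPrime.ne_top ‹y.IsPrime›
      (top_le_iff.1 (ht ▸ hle))) (Ideal.map_le_iff_le_comap.1 le_sup_left)])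
  rw [Ideal.map_sup, Ideal.map_map _ (algebraMap (A ⊗[R] S) (Localization.AtPrime y)), hϖ,
    Ideal.map_span _ ({ϖ} : Set S), Set.image_singleton, Ideal.map_span, Set.image_singleton] at hmax
  rw [map_localRingHom_maximalIdeal, ← hmax, Ideal.map_map]
  rfl

variable [IsDedekindDomain S] [FaithfulSMul R S]

theorem isRegularLocalRing_tensorProduct {π : R} (hπ : Irreducible π) (p : Ideal A)
    [hp : p.IsMaximal] (hreg : IsRegularLocalRing (Localization.AtPrime p))
    (hπp : algebraMap R A π ∈ p)
    (y : Ideal (A ⊗[R] S)) [y.IsPrime] (h : p = y.comap (algebraMap A (A ⊗[R] S)))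
    (P : Ideal S) [P.IsMaximal]
    (hP : P = y.comap (Algebra.TensorProduct.includeRight : S →ₐ[R] A ⊗[R] S))
    (hsep : HasSeparableResidueExt R p ∨ HasSeparableResidueExt R P)
    (hram : P.ramificationIdx R = 1 ∨ algebraMap A (Localization.AtPrime p) (algebraMap R A π) ∉
      maximalIdeal (Localization.AtPrime p) ^ 2) :
    IsRegularLocalRing (Localization.AtPrime y) := by
  classical
  obtain ⟨ϖ, u, hϖ, hu, hπϖ, he0⟩ := exists_uniformizer hπ P
  have hpR : (p.under R).IsMaximal := by rw [under_eq_maximalIdeal_of_mem hπ p hπp]; infer_instance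
  have hm := map_sup_span_uniformizer_eq_maximalIdeal p y h P hP hpR hsep hϖ
  have hπy := localRingHom_algebraMap_eq_includeRightLocalization p y h π
  set φ := Localization.localRingHom p y (algebraMap A (A ⊗[R] S)) h
  set π' := algebraMap A (Localization.AtPrime p) (algebraMap R A π) with hπ'
  have hπm : π' ∈ maximalIdeal (Localization.AtPrime p) := by
    rw [← Localization.AtPrime.map_eq_maximalIdeal]; exact Ideal.mem_map_of_mem _ hπp
  rw [hπϖ, map_mul, map_pow] at hπy
  have : IsNoetherianRing A := Algebra.FiniteType.isNoetherianRing R A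
  have : IsNoetherianRing (A ⊗[R] S) := IsNoetherianRing.of_finite A _
  have : Module.Flat R S := inferInstance
  have hdim := ringKrullDim_le_of_comap_eq p y h.symm
  rw [← hreg.spanFinrank_maximalIdeal] at hdim
  rcases hram with h1 | h1
  · have hϖI : includeRightLocalization y ϖ ∈ (maximalIdeal (Localization.AtPrime p)).map φ := by
      rw [h1, pow_one] at hπy
      rw [← Ideal.mul_unit_mem_iff_mem _ (isUnit_includeRightLocalization y (hP ▸ hu)), ← hπy]
      exact Ideal.mem_map_of_mem _ hπm
    rw [sup_eq_left.2 ((Ideal.span_singleton_le_iff_mem _).2 hϖI)] at hm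
    have hfg := (maximalIdeal (Localization.AtPrime p)).fg_of_isNoetherianRing
    have hfin := Submodule.FG.finite_generators hfg
    refine isRegularLocalRing_of_span_finset
      (s := hfin.toFinset.image φ) ?_ (le_trans ?_ hdim)
    · rw [Finset.coe_image, Set.Finite.coe_toFinset, ← Ideal.map_span, ← hm]
      congr 1
      exact Submodule.span_generators _
    · rw [← Submodule.FG.generators_ncard hfg, Set.ncard_eq_toFinset_card _ hfin]
      exact_mod_cast Finset.card_image_le
  -- Complete `π` to a minimal system of generators and exchange it for `ϖ`, which divides it.
  · obtain ⟨s, -, hcard, hspan⟩ := exists_finset_span_insert_eq_maximalIdeal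
      (Ideal.span_eq (maximalIdeal (Localization.AtPrime p))) hπm h1
    refine isRegularLocalRing_of_span_finset
      (s := insert (includeRightLocalization y ϖ) (s.image φ)) ?_ (le_trans ?_ hdim)
    · have hle : Ideal.span {φ π'} ≤ Ideal.span {includeRightLocalization y ϖ} := by
        rw [hπy, Ideal.span_singleton_le_span_singleton]
        exact (dvd_pow_self _ he0).mul_right _
      rw [← hm, ← hspan, Ideal.map_span, Set.image_insert_eq, Finset.coe_insert,
        Finset.coe_image, Ideal.span_insert, Ideal.span_insert, sup_right_comm,
        sup_eq_right.2 hle]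
    · rw [← hcard]
      exact_mod_cast (Finset.card_insert_le _ _).trans (Nat.succ_le_succ Finset.card_image_le)

theorem exists_not_isRegularLocalRing_tensorProduct {π : R} (hπ : Irreducible π) (p : Ideal A)
    [hp : p.IsMaximal] (hπp : algebraMap R A π ∈ p) (P : Ideal S) [P.IsMaximal]
    (hsep : HasSeparableResidueExt R p ∨ HasSeparableResidueExt R P)
    (hram : 1 < P.ramificationIdx R)
    (hπ2 : algebraMap A (Localization.AtPrime p) (algebraMap R A π) ∈
      maximalIdeal (Localization.AtPrime p) ^ 2) :
    ∃ y : PrimeSpectrum (A ⊗[R] S), y.asIdeal.comap (algebraMap A (A ⊗[R] S)) = p ∧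
      ¬ IsRegularLocalRing (Localization.AtPrime y.asIdeal) := by
  obtain ⟨ϖ, u, hϖ, hu, hπϖ, he0⟩ := exists_uniformizer hπ P
  have hpR' := under_eq_maximalIdeal_of_mem hπ p hπp
  have hpR : (p.under R).IsMaximal := by rw [hpR']; infer_instance
  have : p.LiesOver (maximalIdeal R) := ⟨hpR'.symm⟩
  have : P.LiesOver (maximalIdeal R) := ⟨(IsLocalRing.eq_maximalIdeal
    (Ideal.isMaximal_comap_of_isIntegral_of_isMaximal P)).symm⟩
  obtain ⟨y, hyp, hyP⟩ := exists_prime_tensorProduct (maximalIdeal R) p P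
  refine ⟨y, hyp, ?_⟩
  have hm := map_sup_span_uniformizer_eq_maximalIdeal p y.asIdeal hyp.symm P hyP.symm hpR hsep hϖ
  have hπy := localRingHom_algebraMap_eq_includeRightLocalization p y.asIdeal hyp.symm π
  have hmap := map_localRingHom_maximalIdeal p y.asIdeal hyp.symm
  set φ := Localization.localRingHom p y.asIdeal (algebraMap A (A ⊗[R] S)) hyp.symm
  obtain ⟨k, hk⟩ : ∃ k, P.ramificationIdx R = k + 1 := ⟨_, (Nat.succ_pred he0).symm⟩
  rw [hk] at hram hπϖ
  have : IsNoetherianRing A := Algebra.FiniteType.isNoetherianRing R A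
  have : IsNoetherianRing (A ⊗[R] S) := IsNoetherianRing.of_finite A _
  have hϖ0 : ϖ ≠ 0 := by
    rintro rfl
    rw [zero_pow (Nat.succ_ne_zero k), zero_mul] at hπϖ
    exact hπ.ne_zero ((FaithfulSMul.algebraMap_eq_zero_iff R S).1 hπϖ)
  refine not_isRegularLocalRing_of_pow_mem_sq (k := k) (by omega) hm ?_ ?_
  · rw [hmap, ← map_pow]
    refine notMem_map_localization (q := maximalIdeal R) (P := P) (fun s hs => ?_) y.asIdeal hyp.ge
      hpR'.ge hyP.ge
    rw [hπ.maximalIdeal_eq, Ideal.map_span, Set.image_singleton] at hs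
    rw [hϖ]
    exact mem_of_pow_mul_mem_span hϖ0 hπϖ s hs
  · rw [hπϖ, map_mul, map_pow] at hπy
    rw [← Ideal.mul_unit_mem_iff_mem _ (isUnit_includeRightLocalization y.asIdeal (hyP ▸ hu)), ← hπy,
      ← Ideal.map_pow]
    exact Ideal.mem_map_of_mem _ hπ2

end FiberRegularity

/-! ### Heights of maximal ideals and independence of parameters. -/

section PolynomialRing

theorem isIntegral_quotient_of_finiteType {R A : Type*} [CommRing R] [CommRing A] [Algebra R A]
    [Algebra.FiniteType R A] (M : Ideal A) [M.IsMaximal] [h : (M.under R).IsMaximal] :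
    Algebra.IsIntegral R (A ⧸ M) := by
  let _ : Field (R ⧸ M.under R) := Ideal.Quotient.field _
  let _ : Field (A ⧸ M) := Ideal.Quotient.field _
  have : Algebra.FiniteType R (A ⧸ M) :=
    .of_surjective (Ideal.Quotient.mkₐ R M) Ideal.Quotient.mk_surjective
  have : Algebra.FiniteType (R ⧸ M.under R) (A ⧸ M) :=
    .of_restrictScalars_finiteType R (R ⧸ M.under R) (A ⧸ M)
  have : Module.Finite (R ⧸ M.under R) (A ⧸ M) := finite_of_finite_type_of_isJacobsonRing _ _
  have : Module.Finite R (A ⧸ M) := .trans (R ⧸ M.under R) _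
  infer_instance

theorem isMaximal_under_of_finiteType (R : Type*) {A B : Type*} [CommRing R] [CommRing A]
    [CommRing B] [Algebra R A] [Algebra A B] [Algebra R B] [IsScalarTower R A B]
    [Algebra.FiniteType R B] (Q : Ideal B) [Q.IsMaximal] [(Q.under R).IsMaximal] :
    (Q.under A).IsMaximal := by
  let _ : Field (B ⧸ Q) := Ideal.Quotient.field Q
  have hint : ((Ideal.Quotient.mk Q).comp (algebraMap A B)).IsIntegral := by
    refine RingHom.IsIntegral.tower_top (algebraMap R A) _ ?_
    rw [RingHom.comp_assoc, ← IsScalarTower.algebraMap_eq]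
    exact (isIntegral_quotient_of_finiteType (R := R) Q).isIntegral
  have h := Ideal.isMaximal_comap_of_isIntegral_of_isMaximal' _ hint (⊥ : Ideal (B ⧸ Q))
  rwa [← Ideal.comap_comap, ← RingHom.ker_eq_comap_bot, Ideal.mk_ker] at h

open Polynomial in
-- Each variable raises the height by one; the Nullstellensatz keeps the intermediate contractions
-- maximal.
theorem height_eq_height_comap_C_add {R : Type*} [CommRing R] [IsNoetherianRing R] (n : ℕ)
    (M : Ideal (MvPolynomial (Fin n) R)) [M.IsMaximal] (h : (M.under R).IsMaximal) :
    M.height = (M.under R).height + n := by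
  induction n with
  | zero =>
    let e := (MvPolynomial.isEmptyAlgEquiv R (Fin 0)).toRingEquiv
    have : M.under R = M.comap e.symm := by
      rfl
    rw [this, e.symm.height_comap, Nat.cast_zero, add_zero]
  | succ n ih =>
    let e := (MvPolynomial.finSuccEquiv R n)
    let Q : Ideal (MvPolynomial (Fin n) R)[X] := M.comap e.toRingEquiv.symm
    have hQ : Q.IsMaximal := Ideal.comap_isMaximal_of_equiv e.toRingEquiv.symm
    have hQR : Q.under R = M.under R := by
      ext a
      change e.symm (algebraMap R _ a) ∈ M ↔ _
      rw [AlgEquiv.commutes]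
      rfl
    have hQR' : (Q.under R).IsMaximal := hQR ▸ h
    have hM' : (Q.under (MvPolynomial (Fin n) R)).IsMaximal := isMaximal_under_of_finiteType R Q
    have hlies : (Q.under (MvPolynomial (Fin n) R)).under R = M.under R := by
      rw [← hQR, Ideal.under_under]
    have : Q.LiesOver (Q.under (MvPolynomial (Fin n) R)) := ⟨rfl⟩
    have h1 := Polynomial.height_eq_height_add_one (Q.under (MvPolynomial (Fin n) R)) Q
    rw [ih _ (hlies ▸ h), hlies, e.toRingEquiv.symm.height_comap] at h1
    rw [h1]
    push_cast
    ring

/-- If `a i ∉ M`, then `G i` is redundant modulo `M ^ 2`. By Nakayama `M` is minimal over the ideal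
of the other generators, too few for its height. -/
theorem forall_mem_of_sum_mul_mem_sq {P ι : Type*} [CommRing P] [IsNoetherianRing P] [Fintype ι]
    {M : Ideal P} [hM : M.IsMaximal] {G : ι → P} (hG : M = Ideal.span (Set.range G))
    (hht : (Fintype.card ι : ℕ∞) ≤ M.height) {a : ι → P} (ha : ∑ i, a i * G i ∈ M ^ 2) (i : ι) :
    a i ∈ M := by
  classical
  by_contra hai
  set N : Ideal P := Ideal.span ((Finset.univ.erase i).image G : Finset P) with hN
  have hGM : ∀ j, G j ∈ M := fun j => hG ▸ Ideal.subset_span ⟨j, rfl⟩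
  have hGN : ∀ j ≠ i, G j ∈ N := fun j hj => Ideal.subset_span (by
    simpa using ⟨j, hj, rfl⟩)
  have hNM : N ≤ M := Ideal.span_le.2 fun z hz => by
    obtain ⟨j, -, rfl⟩ := Finset.mem_image.1 (Finset.mem_coe.1 hz); exact hGM j
  obtain ⟨b, hb⟩ : ∃ b, 1 - b * a i ∈ M := by
    obtain ⟨b, m, hm, h⟩ := hM.exists_inv hai
    exact ⟨b, by rwa [← h, add_sub_cancel_left]⟩
  have hle : M ≤ N ⊔ M • M := by
    rw [smul_eq_mul, ← pow_two]
    conv_lhs => rw [hG]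
    rw [Ideal.span_le]
    rintro _ ⟨j, rfl⟩
    by_cases hj : j = i
    · subst hj
      have h1 : G j = (1 - b * a j) * G j + b * (∑ k, a k * G k) -
          b * ∑ k ∈ Finset.univ.erase j, a k * G k := by
        rw [← Finset.add_sum_erase _ _ (Finset.mem_univ j)]; ring
      rw [h1]
      refine Ideal.sub_mem _ (Ideal.mem_sup_right (Ideal.add_mem _ ?_ (Ideal.mul_mem_left _ _ ha)))
        (Ideal.mem_sup_left (Ideal.mul_mem_left _ _ (Ideal.sum_mem _ fun k hk =>
          Ideal.mul_mem_left _ _ (hGN k (Finset.ne_of_mem_erase hk)))))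
      rw [pow_two]; exact Ideal.mul_mem_mul hb (hGM j)
    · exact Ideal.mem_sup_left (hGN j hj)
  obtain ⟨r, hr, hrM⟩ := Submodule.exists_sub_one_mem_and_smul_le_of_fg_of_le_sup
    (IsNoetherian.noetherian M) le_rfl hle
  have hmin : M ∈ N.minimalPrimes := by
    refine ⟨⟨inferInstance, hNM⟩, fun Q ⟨hQ, hNQ⟩ hQM z hz => ?_⟩
    have h1 : r * z ∈ Q := hNQ (hrM ⟨z, hz, rfl⟩)
    refine (hQ.mem_or_mem h1).resolve_left fun hrQ => hM.ne_top ((Ideal.eq_top_iff_one _).2 ?_)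
    simpa using M.sub_mem (hQM hrQ) hr
  have h2 := hht.trans (Ideal.height_le_card_of_mem_minimalPrimes_span_finset hmin)
  have h3 : Fintype.card ι ≤ ((Finset.univ.erase i).image G).card := by exact_mod_cast h2
  have h4 := h3.trans Finset.card_image_le
  rw [Finset.card_erase_of_mem (Finset.mem_univ i), Finset.card_univ] at h4
  have : 0 < Fintype.card ι := Fintype.card_pos_iff.2 ⟨i⟩
  omega

end PolynomialRing

/-- Fredholm alternative: a functional vanishing on the column space but not at `w`, rescaled. -/
theorem exists_vecMul_eq_zero_of_forall_mulVec_ne {k : Type*} [Field k] {m n : Type*} [Fintype m]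
    [Fintype n] [DecidableEq m] (J : Matrix m n k) (w : m → k) (h : ∀ v, J *ᵥ v ≠ w) :
    ∃ u : m → k, u ᵥ* J = 0 ∧ u ⬝ᵥ w = 1 := by
  classical
  have hw : w ∉ LinearMap.range J.mulVecLin := fun ⟨v, hv⟩ => h v hv
  obtain ⟨φ, hφw, hφ⟩ := Submodule.exists_dual_map_eq_bot_of_notMem hw inferInstance
  have hφu : ∀ z : m → k, φ z = (fun i => φ (Pi.single i 1)) ⬝ᵥ z := fun z => by
    rw [LinearMap.pi_apply_eq_sum_univ φ z, dotProduct]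
    refine Finset.sum_congr rfl fun i _ => ?_
    rw [smul_eq_mul, mul_comm]
    congr 2
    ext j
    simp [Pi.single_apply, eq_comm]
  refine ⟨(φ w)⁻¹ • fun i => φ (Pi.single i 1), ?_, ?_⟩
  · ext j
    have h1 : φ (J.col j) = 0 := by
      rw [← Submodule.mem_bot (R := k), ← hφ]
      exact ⟨_, ⟨Pi.single j 1, by simp⟩, rfl⟩
    rw [Matrix.smul_vecMul, Pi.smul_apply, Matrix.vecMul]
    change (φ w)⁻¹ • (_ ⬝ᵥ J.col j) = 0
    rw [← hφu, h1, smul_zero]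
  · rw [smul_dotProduct, ← hφu, smul_eq_mul, inv_mul_cancel₀ hφw]

theorem algebraMap_mem_maximalIdeal_sq_iff {A : Type*} [CommRing A] (p : Ideal A) [hp : p.IsMaximal]
    (a : A) : algebraMap A (Localization.AtPrime p) a ∈ maximalIdeal (Localization.AtPrime p) ^ 2 ↔
      a ∈ p ^ 2 := by
  rw [← Localization.AtPrime.map_eq_maximalIdeal, ← Ideal.map_pow]
  refine ⟨fun h => ?_, Ideal.mem_map_of_mem _⟩
  rw [IsLocalization.algebraMap_mem_map_algebraMap_iff p.primeCompl] at h
  obtain ⟨t, ht, h⟩ := h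
  obtain ⟨s, i, hi, hsi⟩ := hp.exists_inv_pow p ht 2
  have : a = s * (t * a) + i * a := by linear_combination -a * hsi
  rw [this]
  exact Ideal.add_mem _ (Ideal.mul_mem_left _ _ h) (Ideal.mul_mem_right _ _ hi)

/-! ### The extended Jacobian matrix and the order of `π` at `x`. -/

section Jacobian

variable {R : Type*} [CommRing R] {n r : ℕ} {f : Fin r → MvPolynomial (Fin n) R}

theorem value_eq_zero_iff (x : PrimeSpectrum (CoordRing R f)) (p : MvPolynomial (Fin n) R) :
    value x p = 0 ↔ p ∈ x.asIdeal.comap (Ideal.Quotient.mk (Ideal.span (Set.range f))) := by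
  rw [value, RingHom.comp_apply, Ideal.Quotient.eq_zero_iff_mem]; rfl

theorem value_surjective (x : PrimeSpectrum (CoordRing R f)) : Function.Surjective (value x) :=
  Ideal.Quotient.mk_surjective.comp Ideal.Quotient.mk_surjective

variable {π : R} {g : Fin n → MvPolynomial (Fin n) R} {x : PrimeSpectrum (CoordRing R f)}

theorem IsPointIdeal.value_g (hxg : IsPointIdeal π g x) (j : Fin n) : value x (g j) = 0 := by
  rw [value_eq_zero_iff, hxg]
  exact Ideal.subset_span (Set.mem_insert_of_mem _ ⟨j, rfl⟩)

theorem IsPointIdeal.value_C (hxg : IsPointIdeal π g x) : value x (MvPolynomial.C π) = 0 := by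
  rw [value_eq_zero_iff, hxg]
  exact Ideal.subset_span (Set.mem_insert _ _)

theorem IsPointIdeal.exists_eq_sum (hxg : IsPointIdeal π g x) {p : MvPolynomial (Fin n) R}
    (hp : value x p = 0) : ∃ (h : Fin n → MvPolynomial (Fin n) R) (c : MvPolynomial (Fin n) R),
      p = ∑ j, h j * g j + MvPolynomial.C π * c := by
  rw [value_eq_zero_iff, hxg, Ideal.mem_span_insert] at hp
  obtain ⟨c, z, hz, rfl⟩ := hp
  obtain ⟨h, rfl⟩ := Ideal.mem_span_range_iff_exists_fun.1 hz
  exact ⟨h, c, by ring⟩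

theorem value_f (x : PrimeSpectrum (CoordRing R f)) (i : Fin r) : value x (f i) = 0 := by
  have : Ideal.Quotient.mk (Ideal.span (Set.range f)) (f i) = 0 :=
    Ideal.Quotient.eq_zero_iff_mem.2 (Ideal.subset_span ⟨i, rfl⟩)
  rw [value, RingHom.comp_apply, this, map_zero]

theorem IsPointIdeal.exists_isExtendedJacobian (hxg : IsPointIdeal π g x) :
    ∃ J w, IsExtendedJacobian π g x J w := by
  choose h c hhc using fun i => hxg.exists_eq_sum (value_f x i)
  exact ⟨Matrix.of fun i j => value x (h i j), fun i => value x (c i), h, c, hhc,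
    fun _ _ => rfl, fun _ => rfl⟩

theorem IsExtendedJacobian.derivMatrix_eq_mul (hxg : IsPointIdeal π g x)
    {J : Matrix (Fin r) (Fin n) (ResField x)} {w : Fin r → ResField x}
    (hJw : IsExtendedJacobian π g x J w) : derivMatrix f x = J * derivMatrix g x := by
  obtain ⟨h, c, hf, hJ, hw⟩ := hJw
  ext i j
  rw [derivMatrix, Matrix.of_apply, hf i, Matrix.mul_apply]
  simp only [map_add, map_sum, Derivation.leibniz, smul_eq_mul, map_mul, hxg.value_g, hxg.value_C,
    zero_mul, add_zero, MvPolynomial.pderiv_C, mul_zero, derivMatrix, Matrix.of_apply, hJ]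

variable [IsDomain R] [IsDiscreteValuationRing R]

/-- Modulo squares, the coefficients in the system of parameters `g₁, …, gₙ, π` are determined
at `x`. -/
theorem IsPointIdeal.value_eq_zero_of_mem_sq (hxg : IsPointIdeal π g x) (hπ : Irreducible π)
    (hmax : x.asIdeal.IsMaximal) {h : Fin n → MvPolynomial (Fin n) R} {c : MvPolynomial (Fin n) R}
    (hhc : ∑ j, h j * g j + MvPolynomial.C π * c ∈
      (x.asIdeal.comap (Ideal.Quotient.mk (Ideal.span (Set.range f)))) ^ 2) :
    (∀ j, value x (h j) = 0) ∧ value x c = 0 := by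
  set M := x.asIdeal.comap (Ideal.Quotient.mk (Ideal.span (Set.range f))) with hM
  have hMmax : M.IsMaximal := Ideal.comap_isMaximal_of_surjective _ Ideal.Quotient.mk_surjective
  -- The index `none` stands for the parameter `π`.
  let G : Option (Fin n) → MvPolynomial (Fin n) R := fun o => o.elim (MvPolynomial.C π) g
  let a : Option (Fin n) → MvPolynomial (Fin n) R := fun o => o.elim c h
  have hG : M = Ideal.span (Set.range G) := by
    rw [hM, hxg]
    congr 1
    ext z
    simp [G, Option.exists, eq_comm]
  have hunder : M.under R = maximalIdeal R := by
    refine under_eq_maximalIdeal_of_mem hπ M ?_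
    rw [hG]; exact Ideal.subset_span ⟨none, rfl⟩
  have hht : (Fintype.card (Option (Fin n)) : ℕ∞) ≤ M.height := by
    rw [height_eq_height_comap_C_add n M (hunder ▸ inferInstance), hunder,
      IsPrincipalIdealRing.height_eq_one_of_isMaximal _ (IsDiscreteValuationRing.not_isField R),
      Fintype.card_option, Fintype.card_fin]
    push_cast
    rw [add_comm]
  have key := forall_mem_of_sum_mul_mem_sq (a := a) hG hht (by
    rw [Fintype.sum_option, add_comm]
    simpa [a, G, mul_comm] using hhc)
  simp only [value_eq_zero_iff]
  exact ⟨fun j => key (some j), key none⟩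

theorem IsExtendedJacobian.unique (hxg : IsPointIdeal π g x) (hπ : Irreducible π)
    (hmax : x.asIdeal.IsMaximal) {J J' : Matrix (Fin r) (Fin n) (ResField x)}
    {w w' : Fin r → ResField x} (h : IsExtendedJacobian π g x J w)
    (h' : IsExtendedJacobian π g x J' w') : J = J' ∧ w = w' := by
  obtain ⟨h, c, hf, hJ, hw⟩ := h
  obtain ⟨h', c', hf', hJ', hw'⟩ := h'
  -- The difference of two expansions of `f i` is an expansion of `0 ∈ M ^ 2`.
  have key : ∀ i, (∀ j, value x (h i j - h' i j) = 0) ∧ value x (c i - c' i) = 0 := by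
    intro i
    refine hxg.value_eq_zero_of_mem_sq hπ hmax ?_
    have : ∑ j, (h i j - h' i j) * g j + MvPolynomial.C π * (c i - c' i) = 0 := by
      simp only [sub_mul, Finset.sum_sub_distrib]
      linear_combination hf' i - hf i
    rw [this]; exact zero_mem _
  constructor
  · ext i j
    rw [hJ, hJ', ← sub_eq_zero, ← map_sub, (key i).1 j]
  · ext i
    rw [hw, hw', ← sub_eq_zero, ← map_sub, (key i).2]

theorem IsExtendedJacobian.exists_mulVec_eq_iff (hxg : IsPointIdeal π g x) (hπ : Irreducible π)
    (hmax : x.asIdeal.IsMaximal) {J : Matrix (Fin r) (Fin n) (ResField x)} {w : Fin r → ResField x}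
    (hJw : IsExtendedJacobian π g x J w) :
    (∃ v, J *ᵥ v = w) ↔ algebraMap R (CoordRing R f) π ∉ x.asIdeal ^ 2 := by
  obtain ⟨h, c, hf, hJ, hw⟩ := hJw
  let _ : Field (ResField x) := Ideal.Quotient.field x.asIdeal
  set M := x.asIdeal.comap (Ideal.Quotient.mk (Ideal.span (Set.range f))) with hM
  have hπM : algebraMap R (CoordRing R f) π ∈ x.asIdeal ^ 2 ↔
      ∃ u : Fin r → MvPolynomial (Fin n) R, MvPolynomial.C π - ∑ i, u i * f i ∈ M ^ 2 := by
    have h1 : x.asIdeal ^ 2 = (M ^ 2).map (Ideal.Quotient.mk (Ideal.span (Set.range f))) := by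
      rw [Ideal.map_pow, hM, Ideal.map_comap_of_surjective _ Ideal.Quotient.mk_surjective]
    have h2 : algebraMap R (CoordRing R f) π =
      Ideal.Quotient.mk (Ideal.span (Set.range f)) (MvPolynomial.C π) := rfl
    rw [h1, h2, ← Ideal.mem_comap,
      Ideal.comap_map_of_surjective' _ Ideal.Quotient.mk_surjective, Ideal.mk_ker,
      Submodule.mem_sup]
    constructor
    · rintro ⟨y, hy, z, hz, h3⟩
      obtain ⟨u, rfl⟩ := Ideal.mem_span_range_iff_exists_fun.1 hz
      exact ⟨u, by rwa [← h3, add_sub_cancel_right]⟩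
    · rintro ⟨u, hu⟩
      exact ⟨_, hu, _, Ideal.mem_span_range_iff_exists_fun.2 ⟨u, rfl⟩, sub_add_cancel _ _⟩
  have hsum : ∀ u : Fin r → MvPolynomial (Fin n) R, MvPolynomial.C π - ∑ i, u i * f i =
      ∑ j, (- ∑ i, u i * h i j) * g j + MvPolynomial.C π * (1 - ∑ i, u i * c i) := by
    intro u
    have h1 : ∑ i, u i * f i =
        ∑ j, (∑ i, u i * h i j) * g j + MvPolynomial.C π * ∑ i, u i * c i := by
      simp only [Finset.sum_mul, Finset.mul_sum]
      rw [Finset.sum_comm, ← Finset.sum_add_distrib]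
      refine Finset.sum_congr rfl fun i _ => ?_
      rw [hf i, mul_add, Finset.mul_sum]
      congr 1
      · exact Finset.sum_congr rfl fun j _ => by ring
      · ring
    rw [h1]
    simp only [neg_mul, Finset.sum_neg_distrib]
    ring
  rw [hπM]
  constructor
  · rintro ⟨v, hv⟩ ⟨u, hu⟩
    rw [hsum] at hu
    obtain ⟨h1, h2⟩ := hxg.value_eq_zero_of_mem_sq hπ hmax hu
    let u' : Fin r → ResField x := fun i => value x (u i)
    have h3 : u' ᵥ* J = 0 := by
      ext j
      have := h1 j
      simp only [map_neg, map_sum, map_mul, neg_eq_zero] at this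
      simpa [Matrix.vecMul, dotProduct, u', hJ] using this
    have h4 : u' ⬝ᵥ w = 1 := by
      simp only [map_sub, map_one, map_sum, map_mul, sub_eq_zero] at h2
      simpa [dotProduct, u', hw] using h2.symm
    rw [← hv, Matrix.dotProduct_mulVec, h3, zero_dotProduct] at h4
    exact zero_ne_one h4
  · intro hno
    by_contra hv
    push Not at hv
    obtain ⟨u', h3, h4⟩ := exists_vecMul_eq_zero_of_forall_mulVec_ne J w hv
    choose u hu using fun i => value_surjective x (u' i)
    refine hno ⟨u, ?_⟩
    have hgM : ∀ p, value x p = 0 → p ∈ M := fun p => (value_eq_zero_iff x p).1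
    rw [hsum, pow_two]
    refine Ideal.add_mem _ (Ideal.sum_mem _ fun j _ => ?_) ?_
    · refine Ideal.mul_mem_mul (hgM _ ?_) (hgM _ (hxg.value_g j))
      have := congrFun h3 j
      simpa [Matrix.vecMul, dotProduct, hJ, hu] using this
    · refine Ideal.mul_mem_mul (hgM _ hxg.value_C) (hgM _ ?_)
      simp only [map_sub, map_one, map_sum, map_mul, hu, sub_eq_zero]
      simpa [dotProduct, hw] using h4.symm

end Jacobian

/-! ### The chain rule when `κ(x)` is separable. -/

section Separable

variable {R : Type*} [CommRing R] {n r : ℕ} {f : Fin r → MvPolynomial (Fin n) R}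
  {π : R} {g : Fin n → MvPolynomial (Fin n) R} {x : PrimeSpectrum (CoordRing R f)}

/-- A kernel vector `v` makes `∑ vⱼ ∂/∂tⱼ` descend to an `R`-derivation of `κ(x)`. Unramifiedness
forces it to vanish, and its values at the coordinates are the `vⱼ`. -/
theorem IsPointIdeal.eq_zero_of_derivMatrix_mulVec_eq_zero (hxg : IsPointIdeal π g x)
    [Algebra.FormallyUnramified R (ResField x)] {v : Fin n → ResField x}
    (hv : derivMatrix g x *ᵥ v = 0) : v = 0 := by
  choose v' hv' using fun j => value_surjective x (v j)
  let d : Derivation R (MvPolynomial (Fin n) R) (MvPolynomial (Fin n) R) :=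
    ∑ j, v' j • MvPolynomial.pderiv j
  have hdapply : ∀ p, d p = ∑ j, MvPolynomial.pderiv j p * v' j := fun p => by
    have h := congrFun (map_sum (Derivation.coeFnAddMonoidHom (R := R)
      (A := MvPolynomial (Fin n) R) (M := MvPolynomial (Fin n) R))
      (fun j => v' j • MvPolynomial.pderiv j) Finset.univ) p
    rw [Finset.sum_apply] at h
    exact h.trans (Finset.sum_congr rfl fun j _ => mul_comm (v' j) _)
  let φ : MvPolynomial (Fin n) R →ₐ[R] ResField x :=
    (Ideal.Quotient.mkₐ R x.asIdeal).comp (Ideal.Quotient.mkₐ R _)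
  have hφ : ∀ p, φ p = value x p := fun _ => rfl
  have hφs : Function.Surjective φ := value_surjective x
  have hdg : ∀ j, φ (d (g j)) = 0 := by
    intro j
    have := congrFun hv j
    simp only [Matrix.mulVec, dotProduct, derivMatrix, Matrix.of_apply, Pi.zero_apply] at this
    rw [← this]
    simp only [hdapply, hφ, hv', map_sum, map_mul]
  have hd : ∀ p, φ p = 0 → φ (d p) = 0 := by
    intro p hp
    obtain ⟨h, c, rfl⟩ := hxg.exists_eq_sum hp
    have hg : ∀ j, φ (g j) = 0 := hxg.value_g
    have hC : φ (MvPolynomial.C π) = 0 := hxg.value_C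
    have hdC : d (MvPolynomial.C π) = 0 := MvPolynomial.derivation_C d π
    simp only [map_add, map_sum, Derivation.leibniz, smul_eq_mul, map_mul, hg, hC, hdC, hdg,
      mul_zero, zero_mul, Finset.sum_const_zero, add_zero]
  have hδ : ∀ z, Derivation.liftOfSurjective hφs hd z = 0 := by
    intro z
    rw [← (Derivation.liftOfSurjective hφs hd).liftKaehlerDifferential_comp_D z,
      Subsingleton.elim (KaehlerDifferential.D R (ResField x) z) 0, map_zero]
  ext j
  have h1 := Derivation.liftOfSurjective_apply hφs hd (MvPolynomial.X j)
  rw [hδ] at h1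
  rw [← hv', Pi.zero_apply, ← hφ, h1]
  congr 1
  simp [hdapply, MvPolynomial.pderiv_X, Pi.single_apply]

theorem IsPointIdeal.mul_derivMatrix_injective (hxg : IsPointIdeal π g x)
    (hmax : x.asIdeal.IsMaximal) [Algebra.FormallyUnramified R (ResField x)] :
    Function.Injective fun J : Matrix (Fin r) (Fin n) (ResField x) => J * derivMatrix g x := by
  let _ : Field (ResField x) := Ideal.Quotient.field x.asIdeal
  have hinj : Function.Injective (derivMatrix g x).mulVec := by
    intro v v' h
    rw [← sub_eq_zero]
    refine hxg.eq_zero_of_derivMatrix_mulVec_eq_zero ?_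
    rw [Matrix.mulVec_sub, sub_eq_zero]
    exact h
  have hunit : IsUnit (derivMatrix g x) := Matrix.mulVec_injective_iff_isUnit.1 hinj
  intro J J' h
  have h1 := congrArg (· * (derivMatrix g x)⁻¹) h
  simpa [Matrix.mul_assoc, Matrix.mul_nonsing_inv _ ((Matrix.isUnit_iff_isUnit_det _).1 hunit)]
    using h1

theorem IsPointIdeal.algebraMap_mem (hxg : IsPointIdeal π g x) :
    algebraMap R (CoordRing R f) π ∈ x.asIdeal := by
  have := hxg.value_C
  rw [value_eq_zero_iff] at this
  exact this

end Separable

/-! ### Regularity of the whole fibre over `x`. -/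

section Fiber

variable {R S : Type*} [CommRing R] [IsDomain R] [IsDiscreteValuationRing R] [CommRing S]
  [Algebra R S] [Module.Finite R S] {n r : ℕ} {f : Fin r → MvPolynomial (Fin n) R}
  {π : R} {g : Fin n → MvPolynomial (Fin n) R} {x : PrimeSpectrum (CoordRing R f)}

variable [IsDedekindDomain S] [FaithfulSMul R S]

theorem IsPointIdeal.fiberRegular (hxg : IsPointIdeal π g x) (hπ : Irreducible π)
    (hmax : x.asIdeal.IsMaximal) (hreg : IsRegularPoint x)
    (hsep : HasSeparableResidueExt R x.asIdeal ∨
      ∀ P : Ideal S, P.IsMaximal → HasSeparableResidueExt R P)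
    (hram : (∀ P : Ideal S, P.IsMaximal → P.ramificationIdx R = 1) ∨
      algebraMap R (CoordRing R f) π ∉ x.asIdeal ^ 2) : FiberRegular S x := by
  intro y hy
  have hyx : x.asIdeal =
      y.asIdeal.comap (algebraMap (CoordRing R f) (BaseChangeRing R f S)) := by rw [← hy]; rfl
  have hP : (y.asIdeal.comap
      (Algebra.TensorProduct.includeRight : S →ₐ[R] CoordRing R f ⊗[R] S)).IsMaximal := by
    refine Ideal.isMaximal_of_isIntegral_of_isMaximal_comap (R := R) _ ?_
    have h1 : (y.asIdeal.comap (Algebra.TensorProduct.includeRight :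
        S →ₐ[R] CoordRing R f ⊗[R] S)).comap (algebraMap R S) = maximalIdeal R := by
      rw [← under_eq_maximalIdeal_of_mem hπ _ hxg.algebraMap_mem, hyx]
      ext a
      change Algebra.TensorProduct.includeRight (algebraMap R S a) ∈ y.asIdeal ↔
        algebraMap (CoordRing R f) (CoordRing R f ⊗[R] S) (algebraMap R _ a) ∈ y.asIdeal
      rw [AlgHom.commutes, ← IsScalarTower.algebraMap_apply]
    rw [h1]
    infer_instance
  exact isRegularLocalRing_tensorProduct hπ x.asIdeal hreg hxg.algebraMap_mem y.asIdeal hyx _ rfl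
    (hsep.imp_right fun h => h _ hP)
    (hram.imp (fun h => h _ hP) fun h => (algebraMap_mem_maximalIdeal_sq_iff _ _).not.2 h)

theorem IsPointIdeal.algebraMap_notMem_sq (hxg : IsPointIdeal π g x) (hπ : Irreducible π)
    (hmax : x.asIdeal.IsMaximal)
    (hsep : HasSeparableResidueExt R x.asIdeal ∨
      ∀ P : Ideal S, P.IsMaximal → HasSeparableResidueExt R P)
    (hram : IsRamifiedExt R S) (h : FiberRegular S x) :
    algebraMap R (CoordRing R f) π ∉ x.asIdeal ^ 2 := by
  intro hπ2
  obtain ⟨P, hP, hram⟩ := hram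
  obtain ⟨y, hyx, hy⟩ := exists_not_isRegularLocalRing_tensorProduct hπ x.asIdeal
    hxg.algebraMap_mem P (hsep.imp_right fun h => h _ hP) hram
    ((algebraMap_mem_maximalIdeal_sq_iff _ _).2 hπ2)
  exact hy (h y (PrimeSpectrum.ext hyx))

end Fiber

end ArithJac

theorem propositione {R K L S : Type*}
    [CommRing R] [IsDomain R] [IsDiscreteValuationRing R]
    [Field K] [Algebra R K] [IsFractionRing R K]
    [Field L] [Algebra K L] [FiniteDimensional K L] [Algebra.IsSeparable K L]
    [Algebra R L] [IsScalarTower R K L]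
    [CommRing S] [Algebra R S] [Algebra S L] [IsScalarTower R S L] [IsIntegralClosure S R L]
    (π : R) (hπ : Irreducible π) {n r : ℕ}
    (f : Fin r → MvPolynomial (Fin n) R) (g : Fin n → MvPolynomial (Fin n) R)
    (x : PrimeSpectrum (ArithJac.CoordRing R f)) (hmax : x.asIdeal.IsMaximal)
    (hxg : ArithJac.IsPointIdeal π g x) (hreg : ArithJac.IsRegularPoint x) :
    -- the unramified case
    (ArithJac.IsUnramifiedExt R S → ArithJac.FiberRegular S x) ∧
    -- the extended Jacobian matrix is well defined
    (∃! Jw : Matrix (Fin r) (Fin n) (ArithJac.ResField x) × (Fin r → ArithJac.ResField x),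
      ArithJac.IsExtendedJacobian π g x Jw.1 Jw.2) ∧
    ∀ (J : Matrix (Fin r) (Fin n) (ArithJac.ResField x)) (w : Fin r → ArithJac.ResField x),
      ArithJac.IsExtendedJacobian π g x J w →
        -- `J` is the unique solution of the chain rule equation
        (ArithJac.HasSeparableResidueExt R x.asIdeal →
          ∀ J' : Matrix (Fin r) (Fin n) (ArithJac.ResField x),
            ArithJac.derivMatrix f x = J' * ArithJac.derivMatrix g x ↔ J' = J) ∧
        -- the ramified case
        ((ArithJac.HasSeparableResidueExt R x.asIdeal ∨
            ∀ P : Ideal S, P.IsMaximal → ArithJac.HasSeparableResidueExt R P) →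
          ArithJac.IsRamifiedExt R S →
            (ArithJac.FiberRegular S x ↔ ∃ v : Fin n → ArithJac.ResField x, J *ᵥ v = w)) := by
  have : IsDomain S := (IsIntegralClosure.algebraMap_injective S R L).isDomain (algebraMap S L)
  have : IsDedekindDomain S := IsIntegralClosure.isDedekindDomain R K L S
  have : Module.Finite R S := IsIntegralClosure.finite R K L S
  have : FaithfulSMul R L := FaithfulSMul.trans R K L
  have : FaithfulSMul R S := (faithfulSMul_iff_algebraMap_injective R S).2 (by
    have h := FaithfulSMul.algebraMap_injective R L
    rw [IsScalarTower.algebraMap_eq R S L] at h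
    exact Function.Injective.of_comp (f := algebraMap S L) h)
  refine ⟨fun hun => ?_, ?_, fun J w hJw => ⟨fun hsep J' => ?_, fun hsep hram => ?_⟩⟩
  · exact hxg.fiberRegular hπ hmax hreg (Or.inr fun P hP => (hun P hP).2)
      (Or.inl fun P hP => (hun P hP).1)
  · obtain ⟨J, w, hJw⟩ := hxg.exists_isExtendedJacobian
    refine ⟨(J, w), hJw, fun Jw' h' => ?_⟩
    obtain ⟨h1, h2⟩ := h'.unique hxg hπ hmax hJw
    exact Prod.ext h1 h2
  · have hunder : (x.asIdeal.under R).IsMaximal := by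
      rw [ArithJac.under_eq_maximalIdeal_of_mem hπ _ hxg.algebraMap_mem]; infer_instance
    have := ArithJac.formallyUnramified_quotient hunder hsep
    rw [hJw.derivMatrix_eq_mul hxg, eq_comm]
    exact (hxg.mul_derivMatrix_injective hmax).eq_iff
  · rw [hJw.exists_mulVec_eq_iff hxg hπ hmax]
    exact ⟨hxg.algebraMap_notMem_sq hπ hmax hsep hram,
      fun h => hxg.fiberRegular hπ hmax hreg hsep (Or.inr h)⟩
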